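/- Let $\mathcal H=(V,E)$ be a hypergraph: $V$ is a finite set and $E$ is a finite multiset of non-empty subsets of $V$ (hyperedges). Its associated bipartite graph $\mathrm{Bip}\,\mathcal H$ has partite sets $V$ and $E$, with $v\in V$ adjacent to $e\in E$ if and only if $v\in e$; we call $\mathcal H$ connected if $\mathrm{Bip}\,\mathcal H$ is connected. For $E'\subseteq E$ let $\mathrm{Bip}\,\mathcal H|_{E'}$ be the bipartite graph formed by $E'$, all edges of $\mathrm{Bip}\,\mathcal H$ incident with elements of $E'$, and their endpoints in $V$; let $\mathrm{Bip}\,\mathcal H-E'$ be the graph obtained from $\mathrm{Bip}\,\mathcal H$ by deleting the nodes in $E'$ (all of $V$ is kept); and let $c(G)$ be the number of connected components of a graph $G$. Put $\mu(\emptyset)=0$ and $\mu(E')=|\bigcup E'|-c(\mathrm{Bip}\,\mathcal H|_{E'})$ for $\emptyset\ne E'\subseteq E$, and let $$P=\Big\{\mathbf a\in\mathbb Z_{\ge0}^{E}:\ \sum_{e\in E'}a_e\le\mu(E')\text{ for all }E'\subseteq E,\ \sum_{e\in E}a_e=\mu(E)\Big\}.$$ Fix any linear order on $E$, and let $\mathbf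 1_e$ ($e\in E$) be the standard basis vectors of $\mathbb Z^E$. For $\mathbf a\in P$ let $\mathrm{Int}(\mathbf a)$ (respectively $\mathrm{Ext}(\mathbf a)$) be the set of those $e\in E$ such that $\mathbf a-\mathbf 1_e+\mathbf 1_{e'}\notin P$ (respectively $\mathbf a+\mathbf 1_e-\mathbf 1_{e'}\notin P$) for all $e'<e$. The interior and exterior polynomials of $\mathcal H$ are $$I_{\mathcal H}(x)=\sum_{\mathbf a\in P}x^{|E|-|\mathrm{Int}(\mathbf a)|},\qquad X_{\mathcal H}(y)=\sum_{\mathbf a\in P}y^{|E|-|\mathrm{Ext}(\mathbf a)|}.$$ Define, with $\min\emptyset=\infty$, - $r_2(\mathcal H)=\min\{|H'|: H'\subseteq E,\ c(\mathrm{Bip}\,\mathcal H-H')\ge3\}$; - $\mathcal H_j(\mathcal H)=\{H'\subseteq E:\ |H'|=j,\ c(\mathrm{Bip}\,\mathcal H-H')=2,\ c(\mathrm{Bip}\,\mathcal H-(H'\setminus\{e\}))=1\text{ for all }e\in H'\}$; - $r_2'(\mathcal H)=\min\{|H'|: H'\subseteq E,\ \mathrm{Bip}\,\mathcal H|_{H'}\text{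 contains at least two cycles}\}$; - $\mathcal C_j(\mathcal H)=\{H'\subseteq E:\ |H'|=j,\ \mathrm{Bip}\,\mathcal H|_{H'}\text{ has exactly one cycle, and its length is }2j\}$; - $g=\sum_{e\in E}\deg_{\mathrm{Bip}\,\mathcal H}(e)-|E|-|V|+1$. Suppose that $\mathcal H$ is connected. Then, with the binomial coefficients $\binom{a}{m}=a(a-1)\cdots(a-m+1)/m!$ for $a\in\mathbb Z$ and $m\in\mathbb Z_{\ge 0}$: (i) for all integers $0\le i<r_2(\mathcal H)$, $$[y^i]X_{\mathcal H}(y)=\binom{|V|-2+i}{i}-\sum_{j=0}^{i}\binom{|V|+i-2-j}{i-j}\,|\mathcal H_j(\mathcal H)|;$$ (ii) for all integers $0\le i<r_2'(\mathcal H)$, $$[x^i]I_{\mathcal H}(x)=\binom{g+i-1}{i}-\sum_{j=0}^{i}\binom{g+i-1-j}{i-j}\,|\mathcal C_j(\mathcal H)|.$$ -/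

import Mathlib

open Finset
open scoped Polynomial

/-! ### Polymatroids and their interior and exterior polynomials -/

section Polymatroid

variable {ι : Type*} [Fintype ι]

/-- The set of bases of the polymatroid with rank function `f`: the vectors `a ∈ ℤ^ι` with
nonnegative entries, `∑_{i ∈ I} a_i ≤ f(I)` for all `I`, and `∑_i a_i = f(ι)`. -/
def polymatroidBases (f : Finset ι → ℤ) : Set (ι → ℤ) :=
  {a | (∀ i, 0 ≤ a i) ∧ (∀ I : Finset ι, ∑ i ∈ I, a i ≤ f I) ∧ ∑ i, a i = f Finset.univ}

theorem polymatroidBases_finite (f : Finset ι → ℤ) : (polymatroidBases f).Finite := by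
  classical
  refine (Set.finite_Icc (0 : ι → ℤ) (fun i => f {i})).subset ?_
  rintro a ⟨h0, h1, -⟩
  exact ⟨fun i => h0 i, fun i => by simpa using h1 {i}⟩

variable [LinearOrder ι]

open Classical in
/-- The set of internally active indices of `a` with respect to `P`: those `i` such that
`a - e_i + e_j ∉ P` for all `j < i`. -/
noncomputable def internallyActive (P : Set (ι → ℤ)) (a : ι → ℤ) : Finset ι :=
  {i | ∀ j < i, a - Pi.single i 1 + Pi.single j 1 ∉ P}

open Classical in
/-- The set of externally active indices of `a` with respect to `P`: those `i` such that
`a + e_i - e_j ∉ P` for all `j < i`. -/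
noncomputable def externallyActive (P : Set (ι → ℤ)) (a : ι → ℤ) : Finset ι :=
  {i | ∀ j < i, a + Pi.single i 1 - Pi.single j 1 ∉ P}

/-- The interior polynomial `∑_{a ∈ P} x^{n - |Int(a)|}` of the polymatroid `P` with rank
function `f`, where `n = |ι|`. -/
noncomputable def interiorPolynomial (f : Finset ι → ℤ) : ℤ[X] :=
  ∑ a ∈ (polymatroidBases_finite f).toFinset,
    Polynomial.X ^ (Fintype.card ι - #(internallyActive (polymatroidBases f) a))

/-- The exterior polynomial `∑_{a ∈ P} y^{n - |Ext(a)|}` of the polymatroid `P` with rank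
function `f`, where `n = |ι|`. -/
noncomputable def exteriorPolynomial (f : Finset ι → ℤ) : ℤ[X] :=
  ∑ a ∈ (polymatroidBases_finite f).toFinset,
    Polynomial.X ^ (Fintype.card ι - #(externallyActive (polymatroidBases f) a))

end Polymatroid

/-! ### Cycles of a graph -/

/-- The set of cycles of a simple graph, each cycle being given by its set of edges. -/
def SimpleGraph.cycleSet {W : Type*} (G : SimpleGraph W) : Set (Set (Sym2 W)) :=
  {C | ∃ (v : W) (w : G.Walk v v), w.IsCycle ∧ C = {x | x ∈ w.edges}}

/-! ### Hypergraphs -/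

/-- A hypergraph with vertex set `V` and a multiset of nonempty hyperedges, indexed by `E`. -/
structure MultiHypergraph (V E : Type*) where
  /-- The set of vertices of a hyperedge. -/
  verts : E → Finset V
  nonempty : ∀ e, (verts e).Nonempty

namespace MultiHypergraph

variable {V E : Type*} (H : MultiHypergraph V E)

/-- The associated bipartite graph `Bip H` with partite sets `V` and `E`. -/
def bip : SimpleGraph (V ⊕ E) where
  Adj
    | Sum.inl v, Sum.inr e => v ∈ H.verts e
    | Sum.inr e, Sum.inl v => v ∈ H.verts e
    | _, _ => False
  symm := ⟨by rintro (v | e) (v' | e') h <;> exact h⟩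
  loopless := ⟨by rintro (v | e) h <;> exact h⟩

/-- A hypergraph is connected if its associated bipartite graph is. -/
def Connected : Prop := H.bip.Connected

/-- The bipartite graph `Bip H|_S` formed by the hyperedges in `S`, all edges of `Bip H` incident
with them, and the endpoints of these edges in `V`. -/
def bipRestrict (S : Finset E) : SimpleGraph {x : V ⊕ E |
    (∃ e ∈ S, x = Sum.inr e) ∨ ∃ e ∈ S, ∃ v ∈ H.verts e, x = Sum.inl v} :=
  H.bip.induce _

/-- The bipartite graph `Bip H - S` obtained from `Bip H` by removing the hyperedges in `S`
(as nodes of `Bip H`, with all edges incident with them); all of `V` is kept. -/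
def bipDelete (S : Finset E) : SimpleGraph {x : V ⊕ E | ∀ e ∈ S, x ≠ Sum.inr e} :=
  H.bip.induce _

open Classical in
/-- The rank function `μ(S) = |⋃ S| - c(Bip H|_S)` for `S ≠ ∅`, and `μ(∅) = 0`. -/
noncomputable def mu (S : Finset E) : ℤ :=
  if S = ∅ then 0
  else (#(S.biUnion H.verts) : ℤ) - (Nat.card (H.bipRestrict S).ConnectedComponent : ℤ)

/-- The interior polynomial `I_H` of a hypergraph: that of the polymatroid of its hypertrees. -/
noncomputable def interiorPoly [Fintype E] [LinearOrder E] : ℤ[X] :=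
  interiorPolynomial H.mu

/-- The exterior polynomial `X_H` of a hypergraph: that of the polymatroid of its hypertrees. -/
noncomputable def exteriorPoly [Fintype E] [LinearOrder E] : ℤ[X] :=
  exteriorPolynomial H.mu

/-- The number of connected components of `Bip H - S`. -/
noncomputable def numComponents (S : Finset E) : ℕ :=
  Nat.card (H.bipDelete S).ConnectedComponent

/-- `r₂(H)`: the least `|S|` such that `Bip H - S` has at least three connected components
(`⊤` if there is no such `S`). -/
noncomputable def r2 : ℕ∞ :=
  ⨅ (S : Finset E) (_ : 3 ≤ H.numComponents S), (#S : ℕ∞)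

open Classical in
/-- `ℋ_j(H)`: the sets `S` of `j` hyperedges such that `Bip H - S` has exactly two connected
components while `Bip H - (S \ {e})` is connected for every `e ∈ S`. -/
def cutSets (j : ℕ) : Set (Finset E) :=
  {S | H.numComponents S = 2 ∧ (∀ e ∈ S, H.numComponents (S.erase e) = 1) ∧ #S = j}

/-- `r₂'(H)`: the least `|S|` such that `Bip H|_S` contains at least two cycles
(`⊤` if there is no such `S`). -/
noncomputable def r2' : ℕ∞ :=
  ⨅ (S : Finset E) (_ : (H.bipRestrict S).cycleSet.Nontrivial), (#S : ℕ∞)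

/-- `𝒞_j(H)`: the sets `S` of `j` hyperedges such that `Bip H|_S` has exactly one cycle and the
length of this cycle is `2j = 2|S|`. -/
def circuitSets (j : ℕ) : Set (Finset E) :=
  {S | ∃ C, (H.bipRestrict S).cycleSet = {C} ∧ C.ncard = 2 * #S ∧ #S = j}

open Classical in
/-- The number `g = ∑_{e ∈ E} deg(e) - |E| - |V| + 1`, with degrees taken in `Bip H`. -/
noncomputable def nullity [Fintype V] [Fintype E] : ℤ :=
  ∑ e : E, (H.bip.degree (Sum.inr e) : ℤ) - Fintype.card E - Fintype.card V + 1

end MultiHypergraph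

/-! For a normalized nonnegative supermodular ρ, call an integer vector b feasible if b(I) ≥ ρ(I)
for all I; the bases are the feasible vectors of total ρ(univ). Every feasible vector arises from
exactly one basis by raising externally active coordinates only. Give the coordinates independent
weights X(1 - X)^j, truncated at a level M so that all sums are finite and the total weight is 1.
The feasible points of the box then weigh (1 - X)^ρ(univ) times the exterior polynomial
(`sum_prodWeight_feasible`).

Modulo X^(k+1), only points with at most k coordinates below M count. If every set of rank at least
2 has more than k elements, such a point is infeasible exactly when it vanishes on a minimal set of
rank one, which is then unique; vanishing on S has weight X^#S. Hence (1 - X)^ρ(univ) times the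
polynomial is 1 - ∑ X^#S modulo X^(k+1) (`X_pow_dvd_of_rank`), and division by (1 - X)^ρ(univ) gives
the binomial formula.

For (i), ρ(S) = μ(E) - μ(E \ S) = c(Bip H - S) - 1. For (ii), the reflection a ↦ m - a with m_e =
|e| - 1 turns internal into external activity, and ρ(S) is the cyclomatic number of Bip H|_S, whose
minimal sets of rank one carry a single cycle through all their hyperedges. Supermodularity comes
from `mu_eq`: μ(S) is the codimension of the space of functions on V constant on each hyperedge of
S. -/

set_option linter.unusedSectionVars false

/-! ### Contrapolymatroids: tight sets, activity and the partition of feasible vectors -/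

section Contrapolymatroid

variable {ι : Type*} [Fintype ι] [LinearOrder ι]

/-- Normalized, nonnegative, supermodular set functions. -/
structure IsSupermodularRank (ρ : Finset ι → ℤ) : Prop where
  empty : ρ ∅ = 0
  nonneg : ∀ S, 0 ≤ ρ S
  add_le : ∀ S T, ρ S + ρ T ≤ ρ (S ∪ T) + ρ (S ∩ T)

/-- The bases of the contrapolymatroid defined by `ρ`. -/
def contraBases (ρ : Finset ι → ℤ) : Set (ι → ℤ) :=
  {a | (∀ I : Finset ι, ρ I ≤ ∑ i ∈ I, a i) ∧ ∑ i, a i = ρ Finset.univ}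

variable {ρ : Finset ι → ℤ}

theorem IsSupermodularRank.mono (h : IsSupermodularRank ρ) {S T : Finset ι} (hST : S ⊆ T) :
    ρ S ≤ ρ T := by
  have := h.add_le S (T \ S)
  rw [Finset.union_sdiff_of_subset hST, Finset.inter_sdiff_self, h.empty] at this
  linarith [h.nonneg (T \ S)]

theorem IsSupermodularRank.tight_union (h : IsSupermodularRank ρ) {d : ι → ℤ}
    (hd : ∀ I : Finset ι, ρ I ≤ ∑ i ∈ I, d i) {S T : Finset ι}
    (hS : ∑ i ∈ S, d i = ρ S) (hT : ∑ i ∈ T, d i = ρ T) :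
    ∑ i ∈ S ∪ T, d i = ρ (S ∪ T) := by
  have h1 := h.add_le S T
  have h2 := Finset.sum_union_inter (s₁ := S) (s₂ := T) (f := d)
  linarith [hd (S ∪ T), hd (S ∩ T)]

/-- A set all of whose elements lie in tight sets avoiding `P` is contained in a tight set. -/
theorem IsSupermodularRank.exists_tight_superset (h : IsSupermodularRank ρ) {d : ι → ℤ}
    (hd : ∀ I : Finset ι, ρ I ≤ ∑ i ∈ I, d i) (N : Finset ι) (J : Finset ι)
    (hJ : ∀ j ∈ J, ∃ I, j ∈ I ∧ Disjoint I N ∧ ∑ i ∈ I, d i = ρ I) :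
    ∃ I, J ⊆ I ∧ Disjoint I N ∧ ∑ i ∈ I, d i = ρ I := by
  induction J using Finset.induction_on with
  | empty => exact ⟨∅, by simp, by simp, by simp [h.empty]⟩
  | insert j J hj ih =>
    obtain ⟨I, hI1, hI2, hI3⟩ := ih fun k hk => hJ k (Finset.mem_insert_of_mem hk)
    obtain ⟨I', hI'1, hI'2, hI'3⟩ := hJ j (Finset.mem_insert_self _ _)
    refine ⟨I' ∪ I, ?_, ?_, h.tight_union hd hI'3 hI3⟩
    · rw [Finset.insert_subset_iff]
      exact ⟨Finset.mem_union_left _ hI'1, hI1.trans Finset.subset_union_right⟩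
    · exact Finset.disjoint_union_left.2 ⟨hI'2, hI2⟩

theorem sum_add_single_sub_single (a : ι → ℤ) (e j : ι) (I : Finset ι) :
    ∑ i ∈ I, (a + Pi.single e 1 - Pi.single j 1 : ι → ℤ) i =
      ∑ i ∈ I, a i + (if e ∈ I then 1 else 0) - (if j ∈ I then 1 else 0) := by
  simp [Finset.sum_add_distrib, Finset.sum_sub_distrib, Finset.sum_pi_single']

/-- The exchange of j for e fails exactly when some tight set contains j but not e. Tight sets are
closed under union, so a single set serves for all j < e. -/
theorem mem_externallyActive_iff (h : IsSupermodularRank ρ) {a : ι → ℤ} (ha : a ∈ contraBases ρ)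
    (e : ι) : e ∈ externallyActive (contraBases ρ) a ↔
      ∃ I : Finset ι, e ∉ I ∧ (∀ j < e, j ∈ I) ∧ ∑ i ∈ I, a i = ρ I := by
  simp only [externallyActive, Finset.mem_filter, Finset.mem_univ, true_and]
  constructor
  · intro hact
    obtain ⟨I, h1, h2, h3⟩ := h.exists_tight_superset ha.1 {e} ({j | j < e} : Finset ι) (by
      intro j hj
      have hje : j < e := by simpa using hj
      have hn := hact j hje
      by_contra hcon
      push Not at hcon
      refine hn ⟨fun I => ?_, ?_⟩
      · rw [sum_add_single_sub_single]
        have hI := ha.1 I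
        by_cases hjI : j ∈ I <;> by_cases heI : e ∈ I <;> simp only [hjI, heI, if_true, if_false]
        · linarith
        · have := hcon I hjI (by simpa using heI)
          have : ρ I < ∑ i ∈ I, a i := lt_of_le_of_ne hI (Ne.symm this)
          omega
        · linarith
        · linarith
      · rw [sum_add_single_sub_single]; simp [ha.2])
    exact ⟨I, by simpa using h2, fun j hj => h1 (by simpa using hj), h3⟩
  · rintro ⟨I, heI, hI, hs⟩ j hj hmem
    have := hmem.1 I
    rw [sum_add_single_sub_single] at this
    simp only [heI, hI j hj, if_true, if_false] at this
    omega

/-- Greedy descent: lower by one the least coordinate that lies in no tight set, and repeat until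
the excess `n` over a basis is used up. -/
theorem exists_contraBasis_le (h : IsSupermodularRank ρ) (n : ℕ) (d : ι → ℤ)
    (hd : ∀ I : Finset ι, ρ I ≤ ∑ i ∈ I, d i) (hn : ∑ i, d i = ρ univ + n) :
    ∃ a ∈ contraBases ρ, a ≤ d ∧ ∀ e, a e ≠ d e → e ∈ externallyActive (contraBases ρ) a := by
  induction n generalizing d with
  | zero => exact ⟨d, ⟨hd, by simpa using hn⟩, le_rfl, fun e he => absurd rfl he⟩
  | succ n ih =>
    -- These are the coordinates that may be lowered. If there were none, a union of tight sets
    -- would make `univ` tight, against the positive excess.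
    let N : Finset ι := {e | ∀ I : Finset ι, e ∈ I → ∑ i ∈ I, d i ≠ ρ I}
    have hN : N.Nonempty := by
      by_contra hcon
      rw [Finset.not_nonempty_iff_eq_empty] at hcon
      obtain ⟨I, h1, -, h3⟩ := h.exists_tight_superset hd ∅ univ (by
        intro j _
        have : j ∉ N := by simp [hcon]
        simp only [N, Finset.mem_filter, Finset.mem_univ, true_and] at this
        push Not at this
        obtain ⟨I, hI⟩ := this
        exact ⟨I, hI.1, by simp, hI.2⟩)
      rw [Finset.univ_subset_iff.1 h1, hn] at h3
      push_cast at h3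
      omega
    obtain ⟨e, heN, hmin⟩ := N.exists_min_image id hN
    have heN' : ∀ I : Finset ι, e ∈ I → ∑ i ∈ I, d i ≠ ρ I := by
      simpa [N] using heN
    let d' : ι → ℤ := d - Pi.single e 1
    have hsum (I : Finset ι) : ∑ i ∈ I, d' i = ∑ i ∈ I, d i - if e ∈ I then 1 else 0 := by
      simp [d', Finset.sum_sub_distrib, Finset.sum_pi_single']
    have hd' (I : Finset ι) : ρ I ≤ ∑ i ∈ I, d' i := by
      rw [hsum]
      split_ifs with heI
      · have := lt_of_le_of_ne (hd I) (Ne.symm (heN' I heI))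
        omega
      · linarith [hd I]
    obtain ⟨a, ha, had, hact⟩ := ih d' hd' (by rw [hsum, hn]; simp; ring)
    have hd'd : d' ≤ d := by
      intro i
      by_cases hi : i = e
      · subst hi; simp [d']
      · simp [d', hi]
    refine ⟨a, ha, had.trans hd'd, fun i hi => ?_⟩
    by_cases hie : i = e
    · subst hie
      rw [mem_externallyActive_iff h ha]
      -- By minimality every j < i lies in a set tight for `d`, and that set avoids `i` since `i`
      -- lies in none. Their union stays tight for the smaller vector `a`, so it witnesses that `i`
      -- is active.
      obtain ⟨I, h1, h2, h3⟩ := h.exists_tight_superset hd {i} ({j | j < i} : Finset ι) (by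
        intro j hj
        have hji : j < i := by simpa using hj
        have : j ∉ N := fun hjN => absurd (hmin j hjN) (by simpa using hji)
        simp only [N, Finset.mem_filter, Finset.mem_univ, true_and] at this
        push Not at this
        obtain ⟨I, hI⟩ := this
        exact ⟨I, hI.1, by simpa using fun hi => heN' I hi hI.2, hI.2⟩)
      refine ⟨I, by simpa using h2, fun j hj => h1 (by simpa using hj), le_antisymm ?_ (ha.1 I)⟩
      rw [← h3]
      exact Finset.sum_le_sum fun k _ => (had.trans hd'd) k
    · exact hact i (by simpa [d', hie] using hi)

/-- At the last coordinate e where the bases differ, the smaller one is below `d`, so e is active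
for it. Its tight set I contains everything before e and omits e. On the complement the other basis
has the larger sum, so on I it falls below ρ(I). -/
theorem contraBasis_le_unique (h : IsSupermodularRank ρ) {d a a' : ι → ℤ}
    (ha : a ∈ contraBases ρ) (ha' : a' ∈ contraBases ρ) (had : a ≤ d) (had' : a' ≤ d)
    (hact : ∀ e, a e ≠ d e → e ∈ externallyActive (contraBases ρ) a)
    (hact' : ∀ e, a' e ≠ d e → e ∈ externallyActive (contraBases ρ) a') : a = a' := by
  by_contra hne
  have key : ∀ {a a' : ι → ℤ} (_ : a ∈ contraBases ρ) (_ : a' ∈ contraBases ρ) (_ : a' ≤ d)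
      (_ : ∀ e, a e ≠ d e → e ∈ externallyActive (contraBases ρ) a) (e : ι)
      (_ : ∀ j, e < j → a j = a' j), ¬ a e < a' e := by
    intro a a' ha ha' had' hact e hej hlt
    obtain ⟨I, h1, h2, h3⟩ := (mem_externallyActive_iff h ha e).1
      (hact e (hlt.trans_le (had' e)).ne)
    have hc : ∑ i ∈ Iᶜ, a i < ∑ i ∈ Iᶜ, a' i := by
      refine Finset.sum_lt_sum (fun i hi => ?_) ⟨e, by simpa using h1, hlt⟩
      rcases lt_trichotomy i e with hie | rfl | hie
      · exact absurd (h2 i hie) (by simpa using hi)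
      · exact hlt.le
      · exact (hej i hie).le
    have e1 := Finset.sum_add_sum_compl I a
    have e2 := Finset.sum_add_sum_compl I a'
    have := ha'.1 I
    linarith [ha.2, ha'.2]
  obtain ⟨e, he, hmax⟩ := ({e | a e ≠ a' e} : Finset ι).exists_max_image id (by
    obtain ⟨e, he⟩ := Function.ne_iff.1 hne
    exact ⟨e, by simpa using he⟩)
  have hgt : ∀ j, e < j → a j = a' j := by
    intro j hj
    by_contra hcon
    exact absurd (hmax j (by simpa using hcon)) (by simpa using hj)
  have he' : a e ≠ a' e := by simpa using he
  rcases lt_or_gt_of_ne he' with hlt | hlt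
  · exact key ha ha' had' hact e hgt hlt
  · exact key ha' ha had hact' e (fun j hj => (hgt j hj).symm) hlt

theorem contraBases_nonneg (h : IsSupermodularRank ρ) {a : ι → ℤ} (ha : a ∈ contraBases ρ) (i : ι) :
    0 ≤ a i := (h.nonneg {i}).trans (by simpa using ha.1 {i})

theorem contraBases_le (h : IsSupermodularRank ρ) {a : ι → ℤ} (ha : a ∈ contraBases ρ) (i : ι) :
    a i ≤ ρ univ := by
  rw [← ha.2]
  exact Finset.single_le_sum (fun j _ => contraBases_nonneg h ha j) (Finset.mem_univ i)

theorem contraBases_finite (h : IsSupermodularRank ρ) : (contraBases ρ).Finite :=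
  (Set.finite_Icc (0 : ι → ℤ) (fun _ => ρ univ)).subset fun _ ha =>
    ⟨fun i => contraBases_nonneg h ha i, fun i => contraBases_le h ha i⟩

/-! ### Truncated weights -/

/-- The weight `y (1 - y)^j` for `j < M`, and `(1 - y)^j` otherwise. -/
noncomputable def truncWeight (M j : ℤ) : ℤ[X] :=
  (if j < M then Polynomial.X else 1) * (1 - Polynomial.X) ^ j.toNat

/-- The tail telescopes downwards from `M`, where the missing factor X absorbs the rest of the
geometric series. -/
theorem sum_truncWeight {M a : ℤ} (h0 : 0 ≤ a) (haM : a ≤ M) :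
    ∑ j ∈ Finset.Icc a M, truncWeight M j = (1 - Polynomial.X) ^ a.toNat := by
  induction a, haM using Int.leInductionDown with
  | base => simp [truncWeight]
  | pred a haM ih =>
    have hI : Finset.Icc (a - 1) M = insert (a - 1) (Finset.Icc a M) := by
      ext j; simp only [Finset.mem_Icc, Finset.mem_insert]; omega
    rw [hI, Finset.sum_insert (by simp), ih (by omega), truncWeight, if_pos (by omega)]
    have : a.toNat = (a - 1).toNat + 1 := by omega
    rw [this, pow_succ]
    ring

/-- The product of the truncated weights of the coordinates. -/
noncomputable def prodWeight (M : ℤ) (b : ι → ℤ) : ℤ[X] := ∏ i, truncWeight M (b i)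

theorem X_pow_dvd_prodWeight (M : ℤ) (b : ι → ℤ) :
    Polynomial.X ^ #{i | b i < M} ∣ prodWeight M b := by
  rw [prodWeight]
  simp only [truncWeight, Finset.prod_mul_distrib]
  rw [Finset.prod_ite]
  simp only [Finset.prod_const, one_pow, mul_one]
  exact dvd_mul_right _ _

theorem sum_prodWeight_eq_zero_on {M : ℤ} (hM : 0 < M) (S : Finset ι) :
    ∑ b ∈ Fintype.piFinset (fun _ : ι => Finset.Icc 0 M) with (∀ i ∈ S, b i = 0),
      prodWeight M b = Polynomial.X ^ #S := by
  have : (Fintype.piFinset (fun _ : ι => Finset.Icc 0 M)).filter (fun b => ∀ i ∈ S, b i = 0) =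
      Fintype.piFinset (fun i : ι => if i ∈ S then {0} else Finset.Icc 0 M) := by
    ext b
    simp only [Finset.mem_filter, Fintype.mem_piFinset]
    constructor
    · rintro ⟨h1, h2⟩ i
      split_ifs with hi
      · simpa using h2 i hi
      · exact h1 i
    · intro hb
      refine ⟨fun i => ?_, fun i hi => ?_⟩
      · have := hb i
        split_ifs at this
        · rw [Finset.mem_singleton] at this; rw [this]; simp [hM.le]
        · exact this
      · have := hb i
        simpa [hi] using this
  rw [this]
  simp only [prodWeight]
  rw [← Finset.prod_univ_sum]
  have : ∀ i : ι, ∑ j ∈ (if i ∈ S then {0} else Finset.Icc 0 M), truncWeight M j =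
      if i ∈ S then (Polynomial.X : ℤ[X]) else 1 := by
    intro i
    split_ifs
    · simp [truncWeight, hM]
    · rw [sum_truncWeight le_rfl hM.le]; simp
  simp [this]

/-- The feasible points of the box are partitioned by their basis, and each part is a product. An
active coordinate contributes a full tail (1 - X)^(a i); an inactive one is fixed at a i < `M` and
contributes an extra factor X. -/
theorem sum_prodWeight_feasible (h : IsSupermodularRank ρ) {M : ℤ} (hM : ρ univ < M) :
    ∑ b ∈ Fintype.piFinset (fun _ : ι => Finset.Icc 0 M) with (∀ I : Finset ι, ρ I ≤ ∑ i ∈ I, b i),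
      prodWeight M b =
    (1 - Polynomial.X) ^ (ρ univ).toNat * ∑ a ∈ (contraBases_finite h).toFinset,
      Polynomial.X ^ (Fintype.card ι - #(externallyActive (contraBases ρ) a)) := by
  classical
  let t : (ι → ℤ) → ι → Finset ℤ := fun a i =>
    if i ∈ externallyActive (contraBases ρ) a then Finset.Icc (a i) M else {a i}
  have hmem {a : ι → ℤ} (ha : a ∈ contraBases ρ) (b : ι → ℤ) :
      b ∈ Fintype.piFinset (t a) ↔ a ≤ b ∧ (∀ i, b i ≤ M) ∧
        ∀ i, a i ≠ b i → i ∈ externallyActive (contraBases ρ) a := by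
    simp only [Fintype.mem_piFinset, t]
    constructor
    · intro hb
      refine ⟨fun i => ?_, fun i => ?_, fun i hi => ?_⟩ <;> have := hb i <;> split_ifs at this with hc
      · exact (Finset.mem_Icc.1 this).1
      · exact (Finset.mem_singleton.1 this).ge
      · exact (Finset.mem_Icc.1 this).2
      · rw [Finset.mem_singleton.1 this]; exact (contraBases_le h ha i).trans hM.le
      · exact hc
      · exact absurd (Finset.mem_singleton.1 this).symm hi
    · rintro ⟨h1, h2, h3⟩ i
      split_ifs with hc
      · exact Finset.mem_Icc.2 ⟨h1 i, h2 i⟩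
      · rw [Finset.mem_singleton]
        by_contra hcon
        exact hc (h3 i (Ne.symm hcon))
  have hunion : (Fintype.piFinset (fun _ : ι => Finset.Icc 0 M)).filter
      (fun b => ∀ I : Finset ι, ρ I ≤ ∑ i ∈ I, b i) =
      (contraBases_finite h).toFinset.biUnion fun a => Fintype.piFinset (t a) := by
    ext b
    simp only [Finset.mem_filter, Finset.mem_biUnion, Set.Finite.mem_toFinset]
    constructor
    · rintro ⟨h1, h2⟩
      obtain ⟨n, hn⟩ := Int.eq_ofNat_of_zero_le (sub_nonneg.2 (h2 univ))
      obtain ⟨a, ha, hab, hact⟩ := exists_contraBasis_le h n b h2 (by linarith)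
      refine ⟨a, ha, (hmem ha b).2 ⟨hab, fun i => ?_, hact⟩⟩
      exact (Finset.mem_Icc.1 (Fintype.mem_piFinset.1 h1 i)).2
    · rintro ⟨a, ha, hb⟩
      obtain ⟨h1, h2, h3⟩ := (hmem ha b).1 hb
      refine ⟨Fintype.mem_piFinset.2 fun i => Finset.mem_Icc.2
        ⟨(contraBases_nonneg h ha i).trans (h1 i), h2 i⟩, fun I => ?_⟩
      exact (ha.1 I).trans (Finset.sum_le_sum fun i _ => h1 i)
  rw [hunion, Finset.sum_biUnion, Finset.mul_sum]
  · refine Finset.sum_congr rfl fun a ha => ?_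
    rw [Set.Finite.mem_toFinset] at ha
    simp only [prodWeight]
    rw [← Finset.prod_univ_sum]
    have hfac : ∀ i : ι, ∑ j ∈ t a i, truncWeight M j = (1 - Polynomial.X) ^ (a i).toNat *
        if i ∈ externallyActive (contraBases ρ) a then (1 : ℤ[X]) else Polynomial.X := by
      intro i
      have h1 := contraBases_le h ha i
      simp only [t]
      split_ifs
      · rw [sum_truncWeight (contraBases_nonneg h ha i) (h1.trans hM.le), mul_one]
      · simp [truncWeight, h1.trans_lt hM, mul_comm]
    rw [Finset.prod_congr rfl fun i _ => hfac i, Finset.prod_mul_distrib, Finset.prod_pow_eq_pow_sum,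
      Finset.prod_ite]
    congr 1
    · congr 1
      rw [← ha.2]
      zify
      rw [Int.toNat_of_nonneg (Finset.sum_nonneg fun i _ => contraBases_nonneg h ha i)]
      exact Finset.sum_congr rfl fun i _ => Int.toNat_of_nonneg (contraBases_nonneg h ha i)
    · simp only [Finset.prod_const, one_pow, one_mul]
      congr 1
      rw [← Finset.card_compl]
      congr 1
      ext i; simp
  · intro a ha a' ha' hne
    rw [Function.onFun, Finset.disjoint_left]
    intro b hb hb'
    simp only [Set.Finite.coe_toFinset] at ha ha'
    obtain ⟨h1, -, h3⟩ := (hmem ha b).1 hb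
    obtain ⟨h1', -, h3'⟩ := (hmem ha' b).1 hb'
    exact hne (contraBasis_le_unique h ha ha' h1 h1' h3 h3')

/-! ### Minimal sets of rank one -/

/-- `S` has rank one, and removing any element lowers the rank to zero. -/
def IsMinimalOne (ρ : Finset ι → ℤ) (S : Finset ι) : Prop :=
  ρ S = 1 ∧ ∀ e ∈ S, ρ (S.erase e) = 0

/-- An element of `S` outside `T` could be erased from `S` without losing `S ∩ T`, leaving positive
rank. -/
theorem IsMinimalOne.subset_of (h : IsSupermodularRank ρ) {S T : Finset ι}
    (hS : IsMinimalOne ρ S) (hT : 1 ≤ ρ (S ∩ T)) : S ⊆ T := by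
  intro e he
  by_contra heT
  have : ρ (S ∩ T) ≤ ρ (S.erase e) := h.mono fun j hj => by
    rw [Finset.mem_inter] at hj
    exact Finset.mem_erase.2 ⟨fun hje => heT (hje ▸ hj.2), hj.1⟩
  rw [hS.2 e he] at this
  omega

theorem exists_isMinimalOne_subset (h : IsSupermodularRank ρ) (I : Finset ι) (hI : ρ I = 1) :
    ∃ S ⊆ I, IsMinimalOne ρ S := by
  induction I using Finset.strongInduction with
  | H I ih =>
    by_cases hmin : ∀ e ∈ I, ρ (I.erase e) = 0
    · exact ⟨I, subset_rfl, hI, hmin⟩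
    · push Not at hmin
      obtain ⟨e, he, hne⟩ := hmin
      have h1 := h.mono (Finset.erase_subset e I)
      have h2 := h.nonneg (I.erase e)
      obtain ⟨S, hS, hS'⟩ := ih _ (Finset.erase_ssubset he) (by omega)
      exact ⟨S, hS.trans (Finset.erase_subset _ _), hS'⟩

/-! ### Expansion modulo X^(k+1) -/

open Classical in
-- All three terms become weighted sums over the same box. Each point either has weight divisible by
-- X^(k+1) or satisfies: feasibility indicator plus number of minimal rank-one sets on which it
-- vanishes equals 1.
theorem X_pow_dvd_of_rank (h : IsSupermodularRank ρ) (k : ℕ)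
    (hk : ∀ S : Finset ι, 2 ≤ ρ S → k < #S) :
    (Polynomial.X : ℤ[X]) ^ (k + 1) ∣
      (1 - Polynomial.X) ^ (ρ univ).toNat * (∑ a ∈ (contraBases_finite h).toFinset,
        Polynomial.X ^ (Fintype.card ι - #(externallyActive (contraBases ρ) a)))
      + ∑ S : Finset ι with IsMinimalOne ρ S ∧ #S ≤ k, Polynomial.X ^ #S - 1 := by
  have hr := h.nonneg univ
  -- Strictly above every coordinate of a basis, and above every coordinate in a set that violates
  -- feasibility.
  set M : ℤ := ρ univ + 1 with hM
  have hMpos : 0 < M := by omega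
  set box := Fintype.piFinset (fun _ : ι => Finset.Icc 0 M)
  have hone : ∑ b ∈ box, prodWeight M b = 1 := by
    have := sum_prodWeight_eq_zero_on hMpos (∅ : Finset ι)
    simpa using this
  have hexp : (1 - Polynomial.X) ^ (ρ univ).toNat * (∑ a ∈ (contraBases_finite h).toFinset,
        Polynomial.X ^ (Fintype.card ι - #(externallyActive (contraBases ρ) a)))
      + ∑ S : Finset ι with IsMinimalOne ρ S ∧ #S ≤ k, Polynomial.X ^ #S - 1 =
      ∑ b ∈ box, prodWeight M b * ((if ∀ I : Finset ι, ρ I ≤ ∑ i ∈ I, b i then 1 else 0) +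
        ∑ S : Finset ι with IsMinimalOne ρ S ∧ #S ≤ k, (if ∀ i ∈ S, b i = 0 then 1 else 0) - 1) := by
    rw [← sum_prodWeight_feasible h (show ρ univ < M by omega)]
    simp only [mul_sub, mul_add, Finset.sum_sub_distrib, Finset.sum_add_distrib, mul_one, hone,
      mul_ite, mul_zero, Finset.mul_sum, ← Finset.sum_filter]
    congr 2
    rw [Finset.sum_comm' (t' := {S : Finset ι | IsMinimalOne ρ S ∧ #S ≤ k}) 
      (s' := fun S => {b ∈ box | ∀ i ∈ S, b i = 0})
      (by intro b S; simp only [Finset.mem_filter, Finset.mem_univ, true_and]; tauto)]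
    refine Finset.sum_congr rfl fun S _ => ?_
    rw [← sum_prodWeight_eq_zero_on hMpos S]
  rw [hexp]
  refine Finset.dvd_sum fun b hb => ?_
  set U : Finset ι := {i | b i < M} with hU
  have hb0 (i : ι) : 0 ≤ b i := (Finset.mem_Icc.1 (Fintype.mem_piFinset.1 hb i)).1
  by_cases hcard : k + 1 ≤ #U
  · exact ((pow_dvd_pow _ hcard).trans (X_pow_dvd_prodWeight M b)).mul_right _
  push Not at hcard
  convert dvd_zero _
  rw [mul_eq_zero]
  right
  split_ifs with hfeas
  · rw [Finset.sum_eq_zero]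
    · simp
    · intro S hS
      rw [if_neg]
      intro hz
      have := hfeas S
      rw [Finset.sum_eq_zero hz, (Finset.mem_filter.1 hS).2.1.1] at this
      omega
  · push Not at hfeas
    obtain ⟨I, hI⟩ := hfeas
    have hIU : I ⊆ U := by
      intro i hi
      have h1 := Finset.single_le_sum (fun j _ => hb0 j) hi
      have h2 := h.mono (Finset.subset_univ I)
      simp only [hU, Finset.mem_filter, Finset.mem_univ, true_and]
      linarith
    have hle1 {J : Finset ι} (hJ : J ⊆ U) : ρ J ≤ 1 := by
      by_contra hcon
      have := hk J (by omega)
      have := Finset.card_le_card hJ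
      omega
    have hI0 : 0 ≤ ∑ i ∈ I, b i := Finset.sum_nonneg fun i _ => hb0 i
    have hI1 := hle1 hIU
    have hsum0 : ∑ i ∈ I, b i = 0 := by omega
    -- From 0 ≤ b(I) < ρ(I) ≤ 1, the violated set has rank one and `b` vanishes on it.
    rw [Finset.sum_eq_zero_iff_of_nonneg fun i _ => hb0 i] at hsum0
    obtain ⟨S, hSI, hS⟩ := exists_isMinimalOne_subset h I (by omega)
    have hSk : #S ≤ k := by
      have := Finset.card_le_card (hSI.trans hIU)
      omega
    rw [Finset.sum_eq_single_of_mem S (by simp [hS, hSk])]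
    · rw [if_pos fun i hi => hsum0 i (hSI hi)]; simp
    · intro T hT hne
      rw [if_neg]
      intro hz
      have hTm := (Finset.mem_filter.1 hT).2.1
      have hTU : T ⊆ U := by
        intro i hi
        simp only [hU, Finset.mem_filter, Finset.mem_univ, true_and, hz i hi, hMpos]
      -- The union has rank at most one, so supermodularity forces the intersection to have rank at
      -- least one; two minimal sets then contain each other.
      have h1 := hle1 (Finset.union_subset (hSI.trans hIU) hTU)
      have h2 := h.add_le S T
      rw [hS.1, hTm.1] at h2
      refine hne (Finset.Subset.antisymm ?_ ?_)
      · exact hTm.subset_of h (by rw [Finset.inter_comm]; omega)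
      · exact hS.subset_of h (by omega)

theorem coeff_invOneSubPow (r k : ℕ) :
    PowerSeries.coeff k (PowerSeries.invOneSubPow ℤ r).val = Ring.choose ((r : ℤ) + k - 1) k := by
  rcases Nat.eq_zero_or_pos r with rfl | hr
  · rw [PowerSeries.invOneSubPow_zero, Units.val_one, PowerSeries.coeff_one]
    rcases Nat.eq_zero_or_pos k with rfl | hk
    · simp
    · rw [if_neg hk.ne']
      have : ((0 : ℕ) : ℤ) + k - 1 = ((k - 1 : ℕ) : ℤ) := by omega
      rw [this, Ring.choose_natCast, Nat.choose_eq_zero_of_lt (by omega)]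
      rfl
  · rw [PowerSeries.invOneSubPow_val_eq_mk_sub_one_add_choose_of_pos _ _ hr, PowerSeries.coeff_mk]
    have : (r : ℤ) + k - 1 = ((r - 1 + k : ℕ) : ℤ) := by omega
    rw [this, Ring.choose_natCast, Nat.choose_symm_add]

theorem coeff_sum_externallyActive (h : IsSupermodularRank ρ) (k : ℕ)
    (hk : ∀ S : Finset ι, 2 ≤ ρ S → k < #S) :
    (∑ a ∈ (contraBases_finite h).toFinset, (Polynomial.X : ℤ[X]) ^
      (Fintype.card ι - #(externallyActive (contraBases ρ) a))).coeff k =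
    Ring.choose (ρ univ + k - 1) k - ∑ j ∈ Finset.range (k + 1),
      Ring.choose (ρ univ + k - 1 - j) (k - j) *
        ({S : Finset ι | IsMinimalOne ρ S ∧ #S = j}.ncard : ℤ) := by
  classical
  obtain ⟨D, hD⟩ := X_pow_dvd_of_rank h k hk
  set F : ℤ[X] := ∑ a ∈ (contraBases_finite h).toFinset, (Polynomial.X : ℤ[X]) ^
      (Fintype.card ι - #(externallyActive (contraBases ρ) a))
  set r := (ρ univ).toNat with hr
  have hrρ : ρ univ = r := (Int.toNat_of_nonneg (h.nonneg univ)).symm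
  set u : PowerSeries ℤ := (PowerSeries.invOneSubPow ℤ r).val with hu
  have hinv : u * (1 - PowerSeries.X) ^ r = 1 := by
    rw [← PowerSeries.invOneSubPow_inv_eq_one_sub_pow]
    exact (PowerSeries.invOneSubPow ℤ r).val_inv
  -- Multiplying the congruence by the inverse of (1 - X)^r leaves a multiple of X^(k+1), invisible
  -- to the coefficient at `k`.
  have hF : (F : PowerSeries ℤ) = u - ∑ S : Finset ι with IsMinimalOne ρ S ∧ #S ≤ k,
      u * PowerSeries.X ^ #S + u * (D : PowerSeries ℤ) * PowerSeries.X ^ (k + 1) := by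
    have hD' := congrArg (fun p : ℤ[X] => u * (p : PowerSeries ℤ)) hD
    have hcast : ((∑ S : Finset ι with IsMinimalOne ρ S ∧ #S ≤ k, (Polynomial.X : ℤ[X]) ^ #S :
        ℤ[X]) : PowerSeries ℤ) =
        ∑ S : Finset ι with IsMinimalOne ρ S ∧ #S ≤ k, PowerSeries.X ^ #S := by
      rw [← Polynomial.coeToPowerSeries.ringHom_apply, map_sum]
      simp
    simp only [Polynomial.coe_sub, Polynomial.coe_add, Polynomial.coe_mul, Polynomial.coe_pow,
      Polynomial.coe_one, Polynomial.coe_X, hcast] at hD'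
    rw [← Finset.mul_sum]
    linear_combination hD' - (F : PowerSeries ℤ) * hinv
  have hcoeff : F.coeff k = PowerSeries.coeff k (F : PowerSeries ℤ) := by simp
  rw [hcoeff, hF]
  simp only [map_add, map_sub, map_sum, PowerSeries.coeff_mul_X_pow']
  rw [if_neg (by omega), add_zero, coeff_invOneSubPow, ← hrρ]
  congr 1
  rw [← Finset.sum_fiberwise_of_maps_to (t := Finset.range (k + 1)) (g := fun S => #S)
    (by intro S hS; have := (Finset.mem_filter.1 hS).2.2; simp; omega)]
  refine Finset.sum_congr rfl fun j hj => ?_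
  have hjk : j ≤ k := by simpa [Nat.lt_succ_iff] using hj
  have hset : {S : Finset ι | IsMinimalOne ρ S ∧ #S = j} =
      (({S : Finset ι | IsMinimalOne ρ S ∧ #S ≤ k} : Finset (Finset ι)).filter
        (fun S => #S = j) : Finset (Finset ι)) := by
    ext S
    simp only [Set.mem_ofPred_eq, Finset.coe_filter, Finset.mem_filter, Finset.mem_univ, true_and]
    constructor
    · rintro ⟨h1, h2⟩; exact ⟨⟨h1, by omega⟩, h2⟩
    · rintro ⟨⟨h1, -⟩, h2⟩; exact ⟨h1, h2⟩
  rw [hset, Set.ncard_coe_finset, mul_comm, ← nsmul_eq_mul, ← Finset.sum_const]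
  refine Finset.sum_congr rfl fun S hS => ?_
  have hSj : #S = j := (Finset.mem_filter.1 hS).2
  rw [hSj, if_pos hjk, hu, coeff_invOneSubPow, ← hrρ]
  congr 1
  omega

/-! ### Exterior and interior polynomials -/

theorem coeff_exteriorPolynomial {f : Finset ι → ℤ}
    (h : IsSupermodularRank fun S => f univ - f (univ \ S)) (h0 : f ∅ = 0) (k : ℕ)
    (hk : ∀ S : Finset ι, 2 ≤ f univ - f (univ \ S) → k < #S) :
    (exteriorPolynomial f).coeff k =
    Ring.choose (f univ + k - 1) k - ∑ j ∈ Finset.range (k + 1),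
      Ring.choose (f univ + k - 1 - j) (k - j) *
        ({S : Finset ι | IsMinimalOne (fun S => f univ - f (univ \ S)) S ∧ #S = j}.ncard : ℤ) := by
  have key : polymatroidBases f = contraBases fun S => f univ - f (univ \ S) := by
    ext a
    simp only [polymatroidBases, contraBases, Set.mem_ofPred_eq]
    have hc (I : Finset ι) : ∑ i ∈ univ \ I, a i + ∑ i ∈ I, a i = ∑ i, a i :=
      Finset.sum_sdiff (Finset.subset_univ I)
    constructor
    · rintro ⟨-, h2, h3⟩
      refine ⟨fun I => ?_, by simpa [h0] using h3⟩
      linarith [hc I, h2 (univ \ I)]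
    · intro ha
      refine ⟨fun i => contraBases_nonneg h (show a ∈ contraBases _ from ha) i, fun I => ?_,
        by simpa [h0] using ha.2⟩
      have h1 := ha.1 (univ \ I)
      have h2 := ha.2
      simp only [sdiff_self, Finset.sdiff_sdiff_eq_self (Finset.subset_univ I)] at h1 h2
      simp only [Finset.bot_eq_empty, h0] at h2
      linarith [hc I]
  have := coeff_sum_externallyActive h k hk
  simp only [sdiff_self, Finset.bot_eq_empty, h0, sub_zero] at this
  rw [← this, exteriorPolynomial]
  congr 1
  simp only [key]

/-- The reflection a ↦ m - a reverses the rank inequalities and the direction of exchanges. The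
condition `hf` recovers the nonnegativity of a, which the reflected inequalities do not mention. -/
theorem coeff_interiorPolynomial {f : Finset ι → ℤ} {m : ι → ℤ}
    (h : IsSupermodularRank fun S => ∑ i ∈ S, m i - f S)
    (hf : ∀ i, f (univ \ {i}) ≤ f univ) (k : ℕ)
    (hk : ∀ S : Finset ι, 2 ≤ ∑ i ∈ S, m i - f S → k < #S) :
    (interiorPolynomial f).coeff k =
    Ring.choose (∑ i, m i - f univ + k - 1) k - ∑ j ∈ Finset.range (k + 1),
      Ring.choose (∑ i, m i - f univ + k - 1 - j) (k - j) *
        ({S : Finset ι | IsMinimalOne (fun S => ∑ i ∈ S, m i - f S) S ∧ #S = j}.ncard : ℤ) := by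
  have key (a : ι → ℤ) : a ∈ polymatroidBases f ↔
      m - a ∈ contraBases fun S => ∑ i ∈ S, m i - f S := by
    simp only [polymatroidBases, contraBases, Set.mem_ofPred_eq, Pi.sub_apply,
      Finset.sum_sub_distrib]
    constructor
    · rintro ⟨-, h2, h3⟩
      exact ⟨fun I => by linarith [h2 I], by linarith⟩
    · rintro ⟨h1, h2⟩
      refine ⟨fun i => ?_, fun I => by linarith [h1 I], by linarith⟩
      have hc : ∑ j ∈ univ \ {i}, a j + ∑ j ∈ {i}, a j = ∑ j, a j :=
        Finset.sum_sdiff (Finset.subset_univ {i})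
      rw [Finset.sum_singleton] at hc
      linarith [h1 (univ \ {i}), hf i]
  have hact (a : ι → ℤ) : internallyActive (polymatroidBases f) a =
      externallyActive (contraBases fun S => ∑ i ∈ S, m i - f S) (m - a) := by
    ext e
    simp only [internallyActive, externallyActive, Finset.mem_filter, Finset.mem_univ, true_and,
      key]
    refine forall_congr' fun j => forall_congr' fun _ => ?_
    rw [show m - (a - Pi.single e 1 + Pi.single j 1) = m - a + Pi.single e 1 - Pi.single j 1 by
      abel]
  rw [← coeff_sum_externallyActive h k hk, interiorPolynomial]
  congr 1
  refine Finset.sum_bij' (fun a _ => m - a) (fun a _ => m - a) ?_ ?_ ?_ ?_ ?_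
  · intro a ha; simpa [← key] using ha
  · intro a ha; simpa [key] using ha
  · intro a _; simp
  · intro a _; simp
  · intro a _; rw [hact]

end Contrapolymatroid

/-! ### Connected components and the cyclomatic number -/

namespace SimpleGraph

variable {W : Type*} (G : SimpleGraph W)

/-- The space of rational functions that take the same value at adjacent vertices. -/
def locConst : Submodule ℚ (W → ℚ) where
  carrier := {x | ∀ u v, G.Adj u v → x u = x v}
  add_mem' hx hy u v h := by simp [hx u v h, hy u v h]
  zero_mem' _ _ _ := rfl
  smul_mem' c x hx u v h := by simp [hx u v h]

variable {G}

theorem eq_of_mem_locConst {x : W → ℚ} (hx : x ∈ G.locConst) {u v : W} (h : G.Reachable u v) :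
    x u = x v := by
  obtain ⟨p⟩ := h
  induction p with
  | nil => rfl
  | cons h p ih => exact (hx _ _ h).trans ih

variable (G) in
theorem finrank_locConst [Finite W] :
    Module.finrank ℚ G.locConst = Nat.card G.ConnectedComponent := by
  have : Fintype G.ConnectedComponent := Fintype.ofFinite _
  let f : (G.ConnectedComponent → ℚ) →ₗ[ℚ] (W → ℚ) :=
    LinearMap.funLeft ℚ ℚ G.connectedComponentMk
  have hf : Function.Injective f :=
    LinearMap.funLeft_injective_of_surjective ℚ ℚ _ Quot.mk_surjective
  have hr : LinearMap.range f = G.locConst := by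
    ext x
    constructor
    · rintro ⟨y, rfl⟩ u v h
      simp only [f, LinearMap.funLeft_apply]
      rw [ConnectedComponent.sound h.reachable]
    · intro hx
      refine ⟨fun c => c.lift x fun u v p _ => eq_of_mem_locConst hx ⟨p⟩, ?_⟩
      ext u
      rfl
  rw [← hr, LinearMap.finrank_range_of_inj hf, Module.finrank_pi, Nat.card_eq_fintype_card]

theorem card_connectedComponent_deleteEdges_of_not_isBridge [Finite W] {e : Sym2 W}
    (he : ¬ G.IsBridge e) :
    Nat.card (G.deleteEdges {e}).ConnectedComponent = Nat.card G.ConnectedComponent := by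
  rw [← finrank_locConst, ← finrank_locConst]
  suffices h : (G.deleteEdges {e}).locConst = G.locConst by rw [h]
  ext x
  refine ⟨fun hx u v huv => ?_, fun hx u v huv => hx u v ((deleteEdges_le _) huv)⟩
  by_cases h : s(u, v) = e
  · subst h
    rw [isBridge_iff, not_not] at he
    exact eq_of_mem_locConst hx he
  · exact hx u v (by simp [huv, h])

/-- Restoring the edge imposes one linear equation x u = x v, which lowers the dimension by at most
one. -/
theorem card_connectedComponent_deleteEdges_le [Finite W] (e : Sym2 W) :
    Nat.card (G.deleteEdges {e}).ConnectedComponent ≤ Nat.card G.ConnectedComponent + 1 := by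
  have : Fintype W := Fintype.ofFinite _
  induction e with
  | h u v =>
  rw [← finrank_locConst, ← finrank_locConst]
  let φ : (G.deleteEdges {s(u, v)}).locConst →ₗ[ℚ] ℚ :=
    ((LinearMap.proj u : (W → ℚ) →ₗ[ℚ] ℚ) - LinearMap.proj v).comp (Submodule.subtype _)
  have h1 := LinearMap.finrank_range_add_finrank_ker φ
  have h2 : Module.finrank ℚ (LinearMap.range φ) ≤ 1 :=
    (Submodule.finrank_le _).trans (by simp)
  have h3 : Module.finrank ℚ (LinearMap.ker φ) ≤ Module.finrank ℚ G.locConst := by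
    rw [← LinearMap.finrank_range_of_inj (f := (Submodule.subtype _).comp
      (LinearMap.ker φ).subtype) (Subtype.val_injective.comp Subtype.val_injective)]
    refine Submodule.finrank_mono ?_
    rintro _ ⟨⟨⟨x, hx⟩, hφ⟩, rfl⟩ a b hab
    have huv : x u = x v := by simpa [φ, sub_eq_zero] using hφ
    by_cases h : s(a, b) = s(u, v)
    · rcases Sym2.eq_iff.1 h with ⟨rfl, rfl⟩ | ⟨rfl, rfl⟩
      · exact huv
      · exact huv.symm
    · exact hx a b (by simp only [deleteEdges_adj, Set.mem_singleton_iff]; exact ⟨hab, h⟩)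
  omega

theorem card_connectedComponent_lt_deleteEdges [Finite W] {e : Sym2 W} (heG : e ∈ G.edgeSet)
    (he : G.IsBridge e) :
    Nat.card G.ConnectedComponent < Nat.card (G.deleteEdges {e}).ConnectedComponent := by
  classical
  have : Fintype W := Fintype.ofFinite _
  rw [← finrank_locConst, ← finrank_locConst]
  refine Submodule.finrank_lt_finrank_of_lt (lt_of_le_of_ne
    (fun x hx u v huv => hx u v ((deleteEdges_le _) huv)) fun heq => ?_)
  induction e with
  | h u v =>
  rw [isBridge_iff] at he
  -- The indicator of the component of `u` separates `u` from `v` once the bridge is gone, so the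
  -- two spaces differ.
  have hx : (fun w => if (G.deleteEdges {s(u, v)}).Reachable u w then (1 : ℚ) else 0) ∈
      (G.deleteEdges {s(u, v)}).locConst := by
    intro a b hab
    have : (G.deleteEdges {s(u, v)}).Reachable u a ↔ (G.deleteEdges {s(u, v)}).Reachable u b :=
      ⟨fun h => h.trans hab.reachable, fun h => h.trans hab.symm.reachable⟩
    simp only [this]
  rw [← heq] at hx
  have := hx u v heG
  simp [he] at this

theorem ncard_edgeSet_deleteEdges [Finite W] {e : Sym2 W} (heG : e ∈ G.edgeSet) :
    (G.deleteEdges {e}).edgeSet.ncard + 1 = G.edgeSet.ncard := by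
  rw [edgeSet_deleteEdges]
  exact Set.ncard_sdiff_singleton_add_one heG (Set.toFinite _)

theorem card_le_ncard_edgeSet_add [Finite W] (G : SimpleGraph W) :
    Nat.card W ≤ G.edgeSet.ncard + Nat.card G.ConnectedComponent ∧
    (G.IsAcyclic → G.edgeSet.ncard + Nat.card G.ConnectedComponent = Nat.card W) := by
  have : Fintype W := Fintype.ofFinite _
  induction hn : G.edgeSet.ncard generalizing G with
  | zero =>
    rw [Set.ncard_eq_zero, edgeSet_eq_empty] at hn
    subst hn
    have : Nat.card (⊥ : SimpleGraph W).ConnectedComponent = Nat.card W := by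
      rw [← finrank_locConst, show (⊥ : SimpleGraph W).locConst = ⊤ from
        eq_top_iff.2 fun x _ u v h => h.elim]
      simp
    rw [this]
    simp
  | succ n ih =>
    obtain ⟨e, he⟩ : G.edgeSet.Nonempty := by
      rw [← Set.ncard_pos]; omega
    have hd := ncard_edgeSet_deleteEdges he
    obtain ⟨h1, h2⟩ := ih (G.deleteEdges {e}) (by omega)
    have h3 := G.card_connectedComponent_deleteEdges_le e
    refine ⟨by omega, fun hG => ?_⟩
    have h4 := h2 (hG.anti (deleteEdges_le _))
    have h5 := card_connectedComponent_lt_deleteEdges he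
      (isAcyclic_iff_forall_isBridge.1 hG he)
    omega

theorem cycleSet_nonempty_of_not_isAcyclic (h : ¬ G.IsAcyclic) : G.cycleSet.Nonempty := by
  simp only [IsAcyclic, not_forall, not_not] at h
  obtain ⟨v, w, hw⟩ := h
  exact ⟨_, v, w, hw, rfl⟩

theorem cycleSet_mono {G' : SimpleGraph W} (h : G ≤ G') : G.cycleSet ⊆ G'.cycleSet := by
  rintro _ ⟨v, w, hw, rfl⟩
  refine ⟨v, w.mapLe h, hw.mapLe h, ?_⟩
  simp

theorem exists_not_isBridge_of_mem_cycleSet {C : Set (Sym2 W)} (hC : C ∈ G.cycleSet) :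
    ∃ e ∈ C, e ∈ G.edgeSet ∧ ¬ G.IsBridge e := by
  obtain ⟨v, w, hw, rfl⟩ := hC
  cases w with
  | nil => exact absurd rfl hw.ne_nil
  | cons h p =>
    refine ⟨s(_, _), List.mem_cons_self, h, fun hb => ?_⟩
    exact ((isBridge_iff_forall_cycle_notMem h).1 hb) _ hw (by simp)

theorem subset_edgeSet_of_mem_cycleSet {C : Set (Sym2 W)} (hC : C ∈ G.cycleSet) :
    C ⊆ G.edgeSet := by
  obtain ⟨v, w, -, rfl⟩ := hC
  exact fun e he => w.edges_subset_edgeSet he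

theorem card_lt_of_cycleSet_nonempty [Finite W] (h : G.cycleSet.Nonempty) :
    Nat.card W < G.edgeSet.ncard + Nat.card G.ConnectedComponent := by
  obtain ⟨C, hC⟩ := h
  obtain ⟨e, -, he, hb⟩ := exists_not_isBridge_of_mem_cycleSet hC
  have h1 := ncard_edgeSet_deleteEdges he
  have h2 := card_connectedComponent_deleteEdges_of_not_isBridge hb
  have h3 := (card_le_ncard_edgeSet_add (G.deleteEdges {e})).1
  omega

theorem cycleSet_nonempty_of_card_lt [Finite W]
    (h : Nat.card W < G.edgeSet.ncard + Nat.card G.ConnectedComponent) : G.cycleSet.Nonempty :=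
  cycleSet_nonempty_of_not_isAcyclic fun hG => h.ne' ((card_le_ncard_edgeSet_add G).2 hG)

/-- Deleting a non-bridge edge of one cycle lowers the cyclomatic number only by one, so a cycle
avoiding that edge remains. -/
theorem cycleSet_nontrivial_of_card_lt [Finite W]
    (h : Nat.card W + 1 < G.edgeSet.ncard + Nat.card G.ConnectedComponent) :
    G.cycleSet.Nontrivial := by
  obtain ⟨C, hC⟩ := cycleSet_nonempty_of_card_lt (G := G) (by omega)
  obtain ⟨e, heC, he, hb⟩ := exists_not_isBridge_of_mem_cycleSet hC
  have h1 := ncard_edgeSet_deleteEdges he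
  have h2 := card_connectedComponent_deleteEdges_of_not_isBridge hb
  obtain ⟨C', hC'⟩ := cycleSet_nonempty_of_card_lt (G := G.deleteEdges {e}) (by omega)
  refine ⟨C, hC, C', cycleSet_mono (deleteEdges_le _) hC', fun heq => ?_⟩
  have := subset_edgeSet_of_mem_cycleSet hC' (heq ▸ heC)
  rw [edgeSet_deleteEdges] at this
  exact this.2 rfl

/-- The cycles of an induced subgraph are the cycles of the graph with all vertices in the set. -/
theorem image_cycleSet_induce (s : Set W) :
    (fun C => Sym2.map Subtype.val '' C) '' (G.induce s).cycleSet =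
      {C ∈ G.cycleSet | ∀ e ∈ C, ∀ x ∈ e, x ∈ s} := by
  ext C
  constructor
  · rintro ⟨_, ⟨v, w, hw, rfl⟩, rfl⟩
    refine ⟨⟨v, w.map (Embedding.induce s).toHom,
      hw.map (f := (Embedding.induce s).toHom) Subtype.val_injective, ?_⟩, ?_⟩
    · ext e
      have := Walk.edges_map (Embedding.induce s).toHom w
      simp only [Set.mem_image, Set.mem_ofPred_eq]
      erw [this, List.mem_map]
      rfl
    · rintro _ ⟨e, -, rfl⟩ x hx
      obtain ⟨y, -, rfl⟩ := Sym2.mem_map.1 hx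
      exact y.2
  · rintro ⟨⟨v, w, hw, rfl⟩, hs⟩
    have hsup : ∀ x ∈ w.support, x ∈ s := by
      intro x hx
      obtain ⟨e, he, hxe⟩ := (Walk.mem_support_iff_exists_mem_edges_of_not_nil hw.not_nil).1 hx
      exact hs e he x hxe
    have hmap := Walk.map_induce w hsup
    refine ⟨{e | e ∈ (w.induce s hsup).edges}, ⟨_, w.induce s hsup, ?_, rfl⟩, ?_⟩
    · rw [← hmap] at hw
      exact hw.of_map
    · conv_rhs => rw [← hmap]
      ext e
      have := Walk.edges_map (Embedding.induce s).toHom (w.induce s hsup)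
      simp only [Set.mem_image, Set.mem_ofPred_eq]
      erw [this, List.mem_map]
      rfl

end SimpleGraph

namespace MultiHypergraph

variable {V E : Type*} (H : MultiHypergraph V E)

/-! ### The rank function -/

/-- The space of rational functions on the vertices that are constant on each hyperedge of `S`. -/
def constOn (S : Finset E) : Submodule ℚ (V → ℚ) where
  carrier := {x | ∀ e ∈ S, ∀ v ∈ H.verts e, ∀ w ∈ H.verts e, x v = x w}
  add_mem' hx hy e he v hv w hw := by simp [hx e he v hv w hw, hy e he v hv w hw]
  zero_mem' _ _ _ _ _ _ := rfl
  smul_mem' c x hx e he v hv w hw := by simp [hx e he v hv w hw]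

variable {H}

theorem mem_constOn {S : Finset E} {x : V → ℚ} :
    x ∈ H.constOn S ↔ ∀ e ∈ S, ∀ v ∈ H.verts e, ∀ w ∈ H.verts e, x v = x w := Iff.rfl

theorem constOn_anti {S T : Finset E} (h : S ⊆ T) : H.constOn T ≤ H.constOn S :=
  fun _ hx e he => hx e (h he)

theorem constOn_union [DecidableEq E] (S T : Finset E) :
    H.constOn (S ∪ T) = H.constOn S ⊓ H.constOn T := by
  ext x
  simp only [Submodule.mem_inf, mem_constOn, Finset.mem_union]
  exact ⟨fun h => ⟨fun e he => h e (.inl he), fun e he => h e (.inr he)⟩,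
    fun h e he => he.elim (h.1 e) (h.2 e)⟩

theorem bip_adj_inr_inl {v : V} {e : E} :
    H.bip.Adj (Sum.inr e) (Sum.inl v) ↔ v ∈ H.verts e := Iff.rfl

theorem not_bip_adj_inr_inr {e f : E} : ¬ H.bip.Adj (Sum.inr e) (Sum.inr f) := id

variable [Fintype V] [Fintype E]

/-- A locally constant function on Bip H - S is determined by its restriction to V, because every
remaining hyperedge is nonempty. -/
theorem finrank_constOn_compl [DecidableEq E] (S : Finset E) :
    Module.finrank ℚ (H.constOn (univ \ S)) = H.numComponents S := by
  rw [numComponents, ← SimpleGraph.finrank_locConst]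
  let g : V → {x : V ⊕ E | ∀ e ∈ S, x ≠ Sum.inr e} := fun v => ⟨Sum.inl v, by simp⟩
  let f : (H.bipDelete S).locConst →ₗ[ℚ] (V → ℚ) :=
    (LinearMap.funLeft ℚ ℚ g).comp (Submodule.subtype _)
  have hf : Function.Injective f := by
    rintro ⟨x, hx⟩ ⟨y, hy⟩ hxy
    have hV : ∀ v, x (g v) = y (g v) := fun v => congrFun hxy v
    ext ⟨v | e, he⟩
    · exact hV v
    · obtain ⟨v, hv⟩ := H.nonempty e
      have hadj : (H.bipDelete S).Adj ⟨Sum.inr e, he⟩ (g v) := hv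
      exact (hx _ _ hadj).trans ((hV v).trans (hy _ _ hadj).symm)
  rw [← LinearMap.finrank_range_of_inj hf]
  suffices h : LinearMap.range f = H.constOn (univ \ S) by rw [h]
  ext x
  constructor
  · rintro ⟨⟨y, hy⟩, rfl⟩ e he v hv w hw
    have he' : ∀ e' ∈ S, (Sum.inr e : V ⊕ E) ≠ Sum.inr e' := by
      rintro e' he' h
      cases h
      exact (Finset.mem_sdiff.1 he).2 he'
    have h1 : (H.bipDelete S).Adj (g v) ⟨Sum.inr e, he'⟩ := hv
    have h2 : (H.bipDelete S).Adj (g w) ⟨Sum.inr e, he'⟩ := hw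
    exact (hy _ _ h1).trans (hy _ _ h2).symm
  · intro hx
    refine ⟨⟨fun z => Sum.elim x (fun e => x (H.nonempty e).choose) z.1, ?_⟩, ?_⟩
    · have key : ∀ (e : E) (_ : ∀ e' ∈ S, (Sum.inr e : V ⊕ E) ≠ Sum.inr e'), ∀ v ∈ H.verts e,
          x v = x (H.nonempty e).choose := by
        intro e he v hv
        exact hx e (Finset.mem_sdiff.2 ⟨Finset.mem_univ _, fun h => he e h rfl⟩) v hv _
          (H.nonempty e).choose_spec
      rintro ⟨u | e, hu⟩ ⟨v | e', hv⟩ huv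
      · exact huv.elim
      · exact key e' hv u huv
      · exact (key e hu v huv).symm
      · exact huv.elim
    · ext v
      rfl

open Classical in
-- For nonempty `S`, a function constant on each hyperedge of `S` is a locally constant function on
-- Bip H|_S together with arbitrary values outside ⋃ S. For empty `S` both sides vanish.
theorem mu_eq (S : Finset E) :
    H.mu S = Fintype.card V - Module.finrank ℚ (H.constOn S) := by
  rw [mu]
  split_ifs with hS
  · subst hS
    have : H.constOn ∅ = ⊤ := eq_top_iff.2 fun x _ e he => by simp at he
    rw [this]
    simp
  rw [← SimpleGraph.finrank_locConst]
  set s : Set (V ⊕ E) := {x : V ⊕ E |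
    (∃ e ∈ S, x = Sum.inr e) ∨ ∃ e ∈ S, ∃ v ∈ H.verts e, x = Sum.inl v} with hs
  set B := S.biUnion H.verts with hB
  have hBmem (v : V) : v ∈ B ↔ (Sum.inl v : V ⊕ E) ∈ s := by
    simp [hB, hs]
  have hEmem (e : E) : e ∈ S ↔ (Sum.inr e : V ⊕ E) ∈ s := by
    simp [hs]
  let f : ((H.bipRestrict S).locConst × ({v // v ∉ B} → ℚ)) →ₗ[ℚ] (V → ℚ) :=
    { toFun := fun p v => if h : v ∈ B then p.1.1 ⟨Sum.inl v, (hBmem v).1 h⟩ else p.2 ⟨v, h⟩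
      map_add' := by intro p q; ext v; by_cases h : v ∈ B <;> simp [h]
      map_smul' := by intro c p; ext v; by_cases h : v ∈ B <;> simp [h] }
  have hf : Function.Injective f := by
    rintro ⟨⟨x, hx⟩, y⟩ ⟨⟨x', hx'⟩, y'⟩ hxy
    have hV : ∀ v (h : (Sum.inl v : V ⊕ E) ∈ s), x ⟨Sum.inl v, h⟩ = x' ⟨Sum.inl v, h⟩ := by
      intro v h
      have := congrFun hxy v
      simpa [f, (hBmem v).2 h] using this
    refine Prod.ext (Subtype.ext (funext ?_)) (funext ?_)
    · rintro ⟨v | e, he⟩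
      · exact hV v he
      · obtain ⟨v, hv⟩ := H.nonempty e
        have hvs : (Sum.inl v : V ⊕ E) ∈ s := Or.inr ⟨e, (hEmem e).2 he, v, hv, rfl⟩
        have hadj : (H.bipRestrict S).Adj ⟨Sum.inr e, he⟩ ⟨Sum.inl v, hvs⟩ := hv
        exact (hx _ _ hadj).trans ((hV v hvs).trans (hx' _ _ hadj).symm)
    · rintro ⟨v, hv⟩
      have := congrFun hxy v
      simpa [f, hv] using this
  have hr : LinearMap.range f = H.constOn S := by
    ext x
    constructor
    · rintro ⟨⟨⟨y, hy⟩, z⟩, rfl⟩ e he v hv w hw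
      have hm : ∀ u ∈ H.verts e, u ∈ B := fun u hu => Finset.mem_biUnion.2 ⟨e, he, hu⟩
      have h1 : (H.bipRestrict S).Adj ⟨Sum.inl v, (hBmem v).1 (hm v hv)⟩
        ⟨Sum.inr e, (hEmem e).1 he⟩ := hv
      have h2 : (H.bipRestrict S).Adj ⟨Sum.inl w, (hBmem w).1 (hm w hw)⟩
        ⟨Sum.inr e, (hEmem e).1 he⟩ := hw
      simpa [f, hm v hv, hm w hw] using (hy _ _ h1).trans (hy _ _ h2).symm
    · intro hx
      refine ⟨⟨⟨fun z => Sum.elim x (fun e => x (H.nonempty e).choose) z.1, ?_⟩,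
        fun v => x v⟩, ?_⟩
      · have key : ∀ e ∈ S, ∀ v ∈ H.verts e, x v = x (H.nonempty e).choose :=
          fun e he v hv => hx e he v hv _ (H.nonempty e).choose_spec
        rintro ⟨u | e, hu⟩ ⟨v | e', hv⟩ huv
        · exact huv.elim
        · exact key e' ((hEmem e').2 hv) u huv
        · exact (key e ((hEmem e).2 hu) v huv).symm
        · exact huv.elim
      · ext v
        by_cases h : v ∈ B <;> simp [f, h]
  have h1 := LinearMap.finrank_range_of_inj hf
  rw [hr, Module.finrank_prod, Module.finrank_pi, Fintype.card_subtype_compl] at h1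
  have h2 := Fintype.card_coe B
  have h3 := Finset.card_le_univ B
  rw [h1]
  push_cast [Fintype.card_coe, h3]
  ring

theorem mu_empty : H.mu ∅ = 0 := by simp [mu]

theorem mu_mono {S T : Finset E} (h : S ⊆ T) : H.mu S ≤ H.mu T := by
  rw [mu_eq, mu_eq]
  have := Submodule.finrank_mono (constOn_anti (H := H) h)
  omega

/-- The dimension formula: the space for `S ∪ T` is an intersection, while the one for `S ∩ T` only
contains the sum. -/
theorem mu_union_add_inter_le [DecidableEq E] (S T : Finset E) :
    H.mu (S ∪ T) + H.mu (S ∩ T) ≤ H.mu S + H.mu T := by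
  simp only [mu_eq]
  have h1 := Submodule.finrank_sup_add_finrank_inf_eq (H.constOn S) (H.constOn T)
  rw [← constOn_union] at h1
  have h2 : Module.finrank ℚ ↥(H.constOn S ⊔ H.constOn T) ≤
      Module.finrank ℚ (H.constOn (S ∩ T)) := Submodule.finrank_mono
    (sup_le (constOn_anti Finset.inter_subset_left) (constOn_anti Finset.inter_subset_right))
  omega

theorem mu_singleton (e : E) : H.mu {e} = #(H.verts e) - 1 := by
  classical
  rw [mu, if_neg (Finset.singleton_ne_empty e), Finset.singleton_biUnion]
  congr 1
  have he : (Sum.inr e : V ⊕ E) ∈ {x : V ⊕ E | (∃ e' ∈ ({e} : Finset E), x = Sum.inr e') ∨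
      ∃ e' ∈ ({e} : Finset E), ∃ v ∈ H.verts e', x = Sum.inl v} := by simp
  have hc : (H.bipRestrict {e}).Connected := by
    have hreach : ∀ z, (H.bipRestrict {e}).Reachable ⟨Sum.inr e, he⟩ z := by
      rintro ⟨v | e', hz⟩
      · have : (H.bipRestrict {e}).Adj ⟨Sum.inr e, he⟩ ⟨Sum.inl v, hz⟩ := by
          show v ∈ H.verts e
          simpa using hz
        exact this.reachable
      · have : e' = e := by simpa using hz
        subst this
        rfl
    have : Nonempty _ := ⟨(⟨Sum.inr e, he⟩ : {x : V ⊕ E | _})⟩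
    exact ⟨fun u v => (hreach u).symm.trans (hreach v)⟩
  have := hc.preconnected.subsingleton_connectedComponent
  have : Nonempty (H.bipRestrict {e}).ConnectedComponent :=
    hc.nonempty.map (H.bipRestrict {e}).connectedComponentMk
  exact_mod_cast Nat.card_eq_one_iff_unique.2 ⟨‹_›, ‹_›⟩

theorem numComponents_empty (hH : H.Connected) : H.numComponents ∅ = 1 := by
  have hs : ∀ s : Set (V ⊕ E), s = Set.univ → (H.bip.induce s).Connected := by
    rintro _ rfl
    exact (SimpleGraph.induceUnivIso _).connected_iff.2 hH
  have hc : (H.bipDelete ∅).Connected := hs _ (by simp)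
  have h1 := hc.preconnected.subsingleton_connectedComponent
  have h2 : Nonempty (H.bipDelete ∅).ConnectedComponent :=
    hc.nonempty.map (H.bipDelete ∅).connectedComponentMk
  exact Nat.card_eq_one_iff_unique.2 ⟨h1, h2⟩

theorem mu_univ_sub_mu [DecidableEq E] (hH : H.Connected) (S : Finset E) :
    H.mu univ - H.mu (univ \ S) = H.numComponents S - 1 := by
  have h1 : Module.finrank ℚ (H.constOn univ) = H.numComponents ∅ := by
    rw [← finrank_constOn_compl, Finset.sdiff_empty]
  rw [mu_eq, mu_eq, h1, numComponents_empty hH, finrank_constOn_compl]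
  push_cast
  ring

theorem mu_univ (hH : H.Connected) : H.mu univ = Fintype.card V - 1 := by
  classical
  have h1 : Module.finrank ℚ (H.constOn univ) = H.numComponents ∅ := by
    rw [← finrank_constOn_compl, Finset.sdiff_empty]
  rw [mu_eq, h1, numComponents_empty hH]
  simp

theorem isSupermodularRank_exterior [LinearOrder E] :
    IsSupermodularRank fun S => H.mu univ - H.mu (univ \ S) where
  empty := by simp
  nonneg S := sub_nonneg.2 (mu_mono Finset.sdiff_subset)
  add_le S T := by
    have := mu_union_add_inter_le (H := H) (univ \ S) (univ \ T)
    rw [← Finset.sdiff_inter_distrib_right, ← Finset.sdiff_union_distrib] at this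
    linarith

/-! ### The nullity of a set of hyperedges -/

variable (H) in
/-- The cyclomatic number of `Bip H|_S`. -/
noncomputable def setNullity (S : Finset E) : ℤ := ∑ e ∈ S, (#(H.verts e) - 1 : ℤ) - H.mu S

theorem isSupermodularRank_setNullity [LinearOrder E] : IsSupermodularRank H.setNullity where
  empty := by simp [setNullity, mu_empty]
  nonneg S := by
    rw [setNullity, sub_nonneg]
    induction S using Finset.induction_on with
    | empty => simp [mu_empty]
    | insert e S he ih =>
      have h := mu_union_add_inter_le (H := H) {e} S
      rw [Finset.singleton_inter_of_notMem he, mu_empty, mu_singleton] at h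
      rw [Finset.sum_insert he, Finset.insert_eq]
      linarith
  add_le S T := by
    have h1 := mu_union_add_inter_le (H := H) S T
    have h2 := Finset.sum_union_inter (s₁ := S) (s₂ := T) (f := fun e => (#(H.verts e) - 1 : ℤ))
    simp only [setNullity]
    linarith

theorem degree_inr (e : E) [Fintype (H.bip.neighborSet (Sum.inr e))] :
    H.bip.degree (Sum.inr e) = #(H.verts e) := by
  rw [← SimpleGraph.card_neighborFinset_eq_degree, ← Finset.card_map (Function.Embedding.inl : V ↪ V ⊕ E)]
  congr 1
  ext (v | f)
  · simp [bip_adj_inr_inl]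
  · simp [not_bip_adj_inr_inr]

theorem nullity_eq (hH : H.Connected) : H.nullity = H.setNullity univ := by
  simp only [nullity, setNullity, mu_univ hH, degree_inr, Finset.sum_sub_distrib,
    Finset.sum_const, Finset.card_univ]
  simp
  ring

theorem exists_eq_of_mem_edgeSet {x : Sym2 (V ⊕ E)} (hx : x ∈ H.bip.edgeSet) :
    ∃ e, ∃ v ∈ H.verts e, x = s(Sum.inl v, Sum.inr e) := by
  induction x with
  | h a b =>
  rcases a with v | e <;> rcases b with w | f
  · exact hx.elim
  · exact ⟨f, v, hx, rfl⟩
  · exact ⟨e, w, hx, Sym2.eq_swap⟩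
  · exact hx.elim

theorem ncard_edgeSet_bipRestrict (S : Finset E) :
    (H.bipRestrict S).edgeSet.ncard = ∑ e ∈ S, #(H.verts e) := by
  classical
  rw [← Set.ncard_image_of_injective _ (Sym2.map.injective Subtype.val_injective),
    ← Finset.card_sigma, ← Set.ncard_coe_finset]
  symm
  refine Set.ncard_congr (fun p _ => s(Sum.inl p.2, Sum.inr p.1)) ?_ ?_ ?_
  · rintro ⟨e, v⟩ h
    have h' : e ∈ S ∧ v ∈ H.verts e := by simpa using h
    refine ⟨s(⟨Sum.inl v, Or.inr ⟨e, h'.1, v, h'.2, rfl⟩⟩, ⟨Sum.inr e, Or.inl ⟨e, h'.1, rfl⟩⟩),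
      ?_, rfl⟩
    exact h'.2
  · rintro ⟨e, v⟩ ⟨f, w⟩ - - h
    simpa [and_comm] using h
  · rintro _ ⟨x, hx, rfl⟩
    have hx' : Sym2.map Subtype.val x ∈ H.bip.edgeSet := by
      induction x with
      | h a b => exact hx
    obtain ⟨e, v, hv, hxe⟩ := exists_eq_of_mem_edgeSet hx'
    refine ⟨⟨e, v⟩, ?_, hxe.symm⟩
    have he : (Sum.inr e : V ⊕ E) ∈ Sym2.map Subtype.val x := by rw [hxe]; simp
    obtain ⟨⟨y, hy⟩, -, rfl⟩ := Sym2.mem_map.1 he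
    simpa [hv] using hy

open Classical in
theorem card_verts_bipRestrict (S : Finset E) :
    Nat.card {x : V ⊕ E | (∃ e ∈ S, x = Sum.inr e) ∨ ∃ e ∈ S, ∃ v ∈ H.verts e, x = Sum.inl v} =
      #(S.biUnion H.verts) + #S := by
  rw [← Finset.card_disjSum, Nat.card_coe_set_eq, ← Set.ncard_coe_finset]
  congr 1
  ext (v | e) <;> simp

theorem setNullity_eq (S : Finset E) : H.setNullity S = (H.bipRestrict S).edgeSet.ncard +
    Nat.card (H.bipRestrict S).ConnectedComponent -
    Nat.card {x : V ⊕ E |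
      (∃ e ∈ S, x = Sum.inr e) ∨ ∃ e ∈ S, ∃ v ∈ H.verts e, x = Sum.inl v} := by
  classical
  rw [card_verts_bipRestrict, ncard_edgeSet_bipRestrict, setNullity, mu]
  split_ifs with h
  · subst h
    have : IsEmpty (H.bipRestrict ∅).ConnectedComponent := by
      refine ⟨fun c => ?_⟩
      induction c using SimpleGraph.ConnectedComponent.ind with
      | h v => simpa using v.2
    simp
  · push_cast [Finset.sum_sub_distrib]
    simp
    ring

/-! ### Cycles -/

open Classical in
/-- The hyperedges that occur in a set of edges of `Bip H`. -/
noncomputable def hyperedgesOf (C : Set (Sym2 (V ⊕ E))) : Finset E :=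
  {e | ∃ x ∈ C, (Sum.inr e : V ⊕ E) ∈ x}

theorem mem_hyperedgesOf {C : Set (Sym2 (V ⊕ E))} {e : E} :
    e ∈ hyperedgesOf C ↔ ∃ x ∈ C, (Sum.inr e : V ⊕ E) ∈ x := by
  simp [hyperedgesOf]

/-- Count the edges by their end in E: a hyperedge on the cycle has degree two in it, any other has
degree zero. -/
theorem ncard_of_mem_cycleSet {C : Set (Sym2 (V ⊕ E))} (hC : C ∈ H.bip.cycleSet) :
    C.ncard = 2 * #(hyperedgesOf C) := by
  classical
  obtain ⟨v, w, hw, rfl⟩ := hC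
  set G := w.toSubgraph.spanningCoe with hG
  have hGC : G.edgeSet = {x | x ∈ w.edges} := by
    ext x
    induction x with
    | h a b => simp [hG]
  have hbip : G.IsBipartiteWith ((univ : Finset V).map Function.Embedding.inl : Finset (V ⊕ E))
      ((univ : Finset E).map Function.Embedding.inr : Finset (V ⊕ E)) := by
    refine ⟨?_, fun a b hab => ?_⟩
    · rw [Finset.disjoint_coe, Finset.disjoint_left]
      rintro (a | a) <;> simp
    · have : H.bip.Adj a b := w.toSubgraph.adj_sub (by simpa [hG] using hab)
      rcases a with a | a <;> rcases b with b | b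
      · exact this.elim
      · simp
      · simp
      · exact this.elim
  have hsum := SimpleGraph.isBipartiteWith_sum_degrees_eq_card_edges' hbip
  rw [← hGC, ← SimpleGraph.coe_edgeFinset, Set.ncard_coe_finset, ← hsum, Finset.sum_map,
    mul_comm, ← smul_eq_mul, ← Finset.sum_const]
  symm
  refine Finset.sum_subset_zero_on_sdiff (Finset.subset_univ _) ?_ ?_
  · intro e he
    rw [← SimpleGraph.card_neighborFinset_eq_degree, Finset.card_eq_zero,
      Finset.eq_empty_iff_forall_notMem]
    intro u hu
    refine (Finset.mem_sdiff.1 he).2 (mem_hyperedgesOf.2 ⟨s(Sum.inr e, u), ?_, by simp⟩)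
    simpa using hu
  · intro e he
    obtain ⟨x, hx, hex⟩ := mem_hyperedgesOf.1 he
    have hsup : (Sum.inr e : V ⊕ E) ∈ w.support :=
      (SimpleGraph.Walk.mem_support_iff_exists_mem_edges_of_not_nil hw.not_nil).2
        ⟨x, by simpa [hGC] using hx, hex⟩
    rw [← hw.ncard_neighborSet_toSubgraph_eq_two hsup,
      ← SimpleGraph.card_neighborFinset_eq_degree, ← Set.ncard_coe_finset]
    congr 1
    ext u
    simp [hG]

variable (H) in
/-- The cycles of `Bip H` all of whose hyperedges lie in `S`. -/
def cyclesIn (S : Finset E) : Set (Set (Sym2 (V ⊕ E))) :=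
  {C ∈ H.bip.cycleSet | hyperedgesOf C ⊆ S}

/-- Moves the cycles of all Bip H|_S into one type, so that different `S` can be compared. -/
theorem image_cycleSet_bipRestrict (S : Finset E) :
    (fun C => Sym2.map Subtype.val '' C) '' (H.bipRestrict S).cycleSet = H.cyclesIn S := by
  rw [bipRestrict, SimpleGraph.image_cycleSet_induce, cyclesIn]
  ext C
  simp only [Set.mem_ofPred_eq]
  refine and_congr_right fun hC => ⟨fun h e he => ?_, fun h x hx y hy => ?_⟩
  · obtain ⟨x, hx, hex⟩ := mem_hyperedgesOf.1 he
    simpa using h x hx _ hex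
  · obtain ⟨e, v, hv, rfl⟩ :=
      exists_eq_of_mem_edgeSet (SimpleGraph.subset_edgeSet_of_mem_cycleSet hC hx)
    have heS : e ∈ S := h (mem_hyperedgesOf.2 ⟨_, hx, by simp⟩)
    rcases Sym2.mem_iff.1 hy with rfl | rfl
    · exact Or.inr ⟨e, heS, v, hv, rfl⟩
    · exact Or.inl ⟨e, heS, rfl⟩

theorem image_val_injective {α : Type*} (s : Set α) : Function.Injective
    (fun C : Set (Sym2 s) => Sym2.map Subtype.val '' C) :=
  Set.image_injective.2 (Sym2.map.injective Subtype.val_injective)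

theorem nontrivial_cycleSet_bipRestrict_iff (S : Finset E) :
    (H.bipRestrict S).cycleSet.Nontrivial ↔ (H.cyclesIn S).Nontrivial := by
  rw [← image_cycleSet_bipRestrict, Set.image_nontrivial (image_val_injective _)]

theorem cyclesIn_nonempty_iff (S : Finset E) : (H.cyclesIn S).Nonempty ↔ 1 ≤ H.setNullity S := by
  rw [← image_cycleSet_bipRestrict, Set.image_nonempty, setNullity_eq]
  constructor
  · intro h
    have := SimpleGraph.card_lt_of_cycleSet_nonempty h
    omega
  · intro h
    exact SimpleGraph.cycleSet_nonempty_of_card_lt (by omega)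

theorem nontrivial_cycleSet_bipRestrict (S : Finset E) (h : 2 ≤ H.setNullity S) :
    (H.bipRestrict S).cycleSet.Nontrivial := by
  rw [setNullity_eq] at h
  exact SimpleGraph.cycleSet_nontrivial_of_card_lt (by omega)

theorem exists_cycleSet_bipRestrict_eq_iff (S : Finset E) :
    (∃ C, (H.bipRestrict S).cycleSet = {C} ∧ C.ncard = 2 * #S) ↔
      ∃ C, H.cyclesIn S = {C} ∧ hyperedgesOf C = S := by
  have hcard {C : Set (Sym2 (V ⊕ E))} (hC : C ∈ H.cyclesIn S) :
      C.ncard = 2 * #S ↔ hyperedgesOf C = S := by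
    rw [ncard_of_mem_cycleSet hC.1]
    constructor
    · intro h
      exact Finset.eq_of_subset_of_card_le hC.2 (by omega)
    · intro h
      rw [h]
  constructor
  · rintro ⟨C, hC, hn⟩
    have himg : H.cyclesIn S = {Sym2.map Subtype.val '' C} := by
      rw [← image_cycleSet_bipRestrict, hC, Set.image_singleton]
    refine ⟨_, himg, (hcard (by rw [himg]; rfl)).1 ?_⟩
    rw [Set.ncard_image_of_injective _ (Sym2.map.injective Subtype.val_injective), hn]
  · rintro ⟨C, hC, hT⟩
    have hmem : C ∈ H.cyclesIn S := by rw [hC]; rfl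
    have hmem' := hmem
    rw [← image_cycleSet_bipRestrict] at hmem'
    obtain ⟨C', hC', rfl⟩ := hmem'
    refine ⟨C', ?_, ?_⟩
    · apply (image_val_injective _).image_injective
      rw [image_cycleSet_bipRestrict, hC, Set.image_singleton]
    · rw [← (hcard hmem).2 hT,
        Set.ncard_image_of_injective _ (Sym2.map.injective Subtype.val_injective)]

/-- Positive nullity means that a cycle exists. With at most one cycle in `S`, erasing any hyperedge
destroys it exactly when it passes through all of `S`, that is, when its length is 2|S|. -/
theorem exists_unique_cycle_iff [LinearOrder E] (S : Finset E)
    (hS : ¬ (H.bipRestrict S).cycleSet.Nontrivial) :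
    (∃ C, (H.bipRestrict S).cycleSet = {C} ∧ C.ncard = 2 * #S) ↔
      IsMinimalOne H.setNullity S := by
  have hle : H.setNullity S ≤ 1 := by
    by_contra h
    exact hS (nontrivial_cycleSet_bipRestrict S (by omega))
  rw [exists_cycleSet_bipRestrict_eq_iff]
  rw [nontrivial_cycleSet_bipRestrict_iff, Set.not_nontrivial_iff] at hS
  constructor
  · rintro ⟨C, hC, hT⟩
    refine ⟨le_antisymm hle ((cyclesIn_nonempty_iff S).1 ⟨C, by rw [hC]; rfl⟩), fun e he => ?_⟩
    by_contra hne
    have h0 := (isSupermodularRank_setNullity (H := H)).nonneg (S.erase e)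
    obtain ⟨C', hC'⟩ := (cyclesIn_nonempty_iff (H := H) (S.erase e)).2 (by omega)
    have : C' ∈ H.cyclesIn S := ⟨hC'.1, hC'.2.trans (Finset.erase_subset _ _)⟩
    rw [hC] at this
    obtain rfl : C' = C := this
    have := hC'.2
    rw [hT] at this
    exact Finset.notMem_erase e S (this he)
  · rintro ⟨h1, h2⟩
    obtain ⟨C, hC⟩ := (cyclesIn_nonempty_iff (H := H) S).2 h1.ge
    refine ⟨C, hS.eq_singleton_of_mem hC, hC.2.antisymm fun e he => ?_⟩
    by_contra hcon
    have := (cyclesIn_nonempty_iff (H := H) (S.erase e)).1 ⟨C, hC.1, fun f hf =>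
      Finset.mem_erase.2 ⟨fun hfe => hcon (hfe ▸ hf), hC.2 hf⟩⟩
    have := h2 e he
    omega

end MultiHypergraph

/-! ### The coefficient formulas for hypergraphs -/

theorem mainTheorem3 {V E : Type*} [Fintype V] [Fintype E] [LinearOrder E]
    (H : MultiHypergraph V E) (hH : H.Connected) :
    (∀ i : ℕ, (i : ℕ∞) < H.r2 →
      H.exteriorPoly.coeff i =
        Ring.choose ((Fintype.card V : ℤ) - 2 + i) i -
          ∑ j ∈ Finset.range (i + 1),
            Ring.choose ((Fintype.card V : ℤ) + i - 2 - j) (i - j) *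
              ((H.cutSets j).ncard : ℤ)) ∧
    (∀ i : ℕ, (i : ℕ∞) < H.r2' →
      H.interiorPoly.coeff i =
        Ring.choose (H.nullity + i - 1) i -
          ∑ j ∈ Finset.range (i + 1),
            Ring.choose (H.nullity + i - 1 - j) (i - j) *
              ((H.circuitSets j).ncard : ℤ)) := by
  refine ⟨fun i hi => ?_, fun i hi => ?_⟩
  · have key := coeff_exteriorPolynomial (f := H.mu)
      MultiHypergraph.isSupermodularRank_exterior MultiHypergraph.mu_empty i
    simp only [MultiHypergraph.mu_univ_sub_mu hH] at key
    rw [MultiHypergraph.exteriorPoly, key, MultiHypergraph.mu_univ hH]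
    · congr 1
      · congr 1; ring
      · refine Finset.sum_congr rfl fun j _ => ?_
        congr 2
        · congr 1; ring
        · congr 1
          ext S
          simp only [IsMinimalOne, MultiHypergraph.cutSets, Set.mem_ofPred_eq, and_assoc]
          refine and_congr (by omega) (and_congr_left fun _ => forall₂_congr fun e _ => ?_)
          rw [sub_eq_zero, Nat.cast_eq_one]
          convert Iff.rfl
    · intro S hS
      exact_mod_cast hi.trans_le (iInf₂_le S (by omega : 3 ≤ H.numComponents S))
  · have hcard {S : Finset E} (hS : (H.bipRestrict S).cycleSet.Nontrivial) : i < #S := by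
      exact_mod_cast hi.trans_le (iInf₂_le S hS)
    rw [MultiHypergraph.interiorPoly, coeff_interiorPolynomial
      (m := fun e => (#(H.verts e) - 1 : ℤ)) MultiHypergraph.isSupermodularRank_setNullity
      (fun e => MultiHypergraph.mu_mono (Finset.subset_univ _)) i
      (fun S hS => hcard (MultiHypergraph.nontrivial_cycleSet_bipRestrict S hS)),
      MultiHypergraph.nullity_eq hH]
    congr 1
    refine Finset.sum_congr rfl fun j hj => ?_
    congr 3
    ext S
    refine Iff.trans (and_congr_left fun hSj => (MultiHypergraph.exists_unique_cycle_iff S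
      fun hS => ?_).symm) ?_
    -- Two cycles in `S` would give i < #S = j, whereas j ≤ i.
    · have := hcard hS
      have := Finset.mem_range.1 hj
      omega
    · simp only [MultiHypergraph.circuitSets, Set.mem_ofPred_eq, ← and_assoc, exists_and_right]
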